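/- Let $n\in\mathbb N$, $n\ge 2$, $\alpha\in\mathbb R$, $0<r_1<r_2<\infty$, and let $A_n(r_1,r_2)=\{x\in\mathbb R^n : r_1<|x|<r_2\}$. Let $W_0^{1,2}(A_n(r_1,r_2))$ denote the closure of $C_0^\infty(A_n(r_1,r_2))$ in the Sobolev space $W^{1,2}(A_n(r_1,r_2))$ of (real- or complex-valued) functions in $L^2$ with weak gradient $\nabla f$ in $L^2$. Then for all $f\in W_0^{1,2}(A_n(r_1,r_2))$ both integrals below are finite and $$\int_{A_n(r_1,r_2)} |x|^{\alpha}\,|(\nabla f)(x)|^2\,d^nx \;\ge\; \left\{\frac{(2-\alpha-n)^2}{4}+\left[\frac{\pi}{\ln(r_2/r_1)}\right]^2\right\}\int_{A_n(r_1,r_2)} |x|^{\alpha-2}\,|f(x)|^2\,d^nx .$$ Moreover, the radial function $$f_{\alpha,r_1,r_2,n}(x)=|x|^{(2-\alpha-n)/2}\,\sin\!\left(\frac{\pi}{\ln(r_2/r_1)}\,\ln(|x|/r_1)\right),\qquad x\in A_n(r_1,r_2),$$ is a nonzero element of $W_0^{1,2}(A_n(r_1,r_2))$ for which equality holds. Hence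 the constant is optimal: no real number $C>\frac{(2-\alpha-n)^2}{4}+\big[\frac{\pi}{\ln(r_2/r_1)}\big]^2$ can replace it in the inequality for all $f\in W_0^{1,2}(A_n(r_1,r_2))$. -/

import Mathlib

open MeasureTheory Filter
open scoped Topology ContDiff

noncomputable section

/-- The open spherical shell `{x ∈ ℝⁿ | r₁ < |x| < r₂}`. -/
def sphericalShell (n : ℕ) (r₁ r₂ : ℝ) : Set (EuclideanSpace ℝ (Fin n)) :=
  {x | r₁ < ‖x‖ ∧ ‖x‖ < r₂}

/-- The classical partial derivative `∂ᵢ φ` of a function on `ℝⁿ`. -/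
def partialDeriv {n : ℕ} {F : Type*} [NormedAddCommGroup F] [NormedSpace ℝ F]
    (i : Fin n) (φ : EuclideanSpace ℝ (Fin n) → F) (x : EuclideanSpace ℝ (Fin n)) : F :=
  fderiv ℝ φ x (EuclideanSpace.single i 1)

/-- The classical gradient `(∂₁ φ, …, ∂ₙ φ)` of a scalar function on `ℝⁿ`, as a vector of `𝕜ⁿ`
with its Euclidean norm. -/
def classicalGradient {n : ℕ} {𝕜 : Type*} [RCLike 𝕜] (φ : EuclideanSpace ℝ (Fin n) → 𝕜)
    (x : EuclideanSpace ℝ (Fin n)) : EuclideanSpace 𝕜 (Fin n) :=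
  WithLp.toLp 2 fun i => partialDeriv i φ x

/-- `φ ∈ C₀^∞(Ω)`: smooth with compact support contained in `Ω`. -/
structure IsTestFunction {n : ℕ} {F : Type*} [NormedAddCommGroup F] [NormedSpace ℝ F]
    (Ω : Set (EuclideanSpace ℝ (Fin n))) (φ : EuclideanSpace ℝ (Fin n) → F) : Prop where
  contDiff : ContDiff ℝ ∞ φ
  hasCompactSupport : HasCompactSupport φ
  tsupport_subset : tsupport φ ⊆ Ω

/-- `G` is the weak (distributional) gradient of `f` on the open set `Ω`. -/
structure HasWeakGradient {n : ℕ} {𝕜 : Type*} [RCLike 𝕜] (Ω : Set (EuclideanSpace ℝ (Fin n)))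
    (f : EuclideanSpace ℝ (Fin n) → 𝕜)
    (G : EuclideanSpace ℝ (Fin n) → EuclideanSpace 𝕜 (Fin n)) : Prop where
  locallyIntegrableOn : LocallyIntegrableOn f Ω
  locallyIntegrableOn_gradient : LocallyIntegrableOn G Ω
  integral_eq : ∀ φ : EuclideanSpace ℝ (Fin n) → ℝ, IsTestFunction Ω φ → ∀ i : Fin n,
    ∫ x in Ω, partialDeriv i φ x • f x = - ∫ x in Ω, φ x • G x i

/-- `f ∈ W₀^{1,2}(Ω)`: `f ∈ L²(Ω)` has a weak gradient in `L²(Ω)`, and `f` is the limit of a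
sequence in `C₀^∞(Ω)` with respect to the norm of `W^{1,2}(Ω)`. -/
def MemW012 {n : ℕ} {𝕜 : Type*} [RCLike 𝕜] (Ω : Set (EuclideanSpace ℝ (Fin n)))
    (f : EuclideanSpace ℝ (Fin n) → 𝕜) : Prop :=
  MemLp f 2 (volume.restrict Ω) ∧
  ∃ G : EuclideanSpace ℝ (Fin n) → EuclideanSpace 𝕜 (Fin n),
    HasWeakGradient Ω f G ∧ MemLp G 2 (volume.restrict Ω) ∧
    ∃ φ : ℕ → EuclideanSpace ℝ (Fin n) → 𝕜, (∀ k, IsTestFunction Ω (φ k)) ∧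
      Tendsto (fun k => eLpNorm (fun x => φ k x - f x) 2 (volume.restrict Ω)) atTop (𝓝 0) ∧
      Tendsto (fun k => eLpNorm (fun x => classicalGradient (φ k) x - G x) 2
        (volume.restrict Ω)) atTop (𝓝 0)

/-- The constant `(2 - α - n)² / 4 + (π / ln(r₂/r₁))²`. -/
def shellHardyConst (n : ℕ) (α r₁ r₂ : ℝ) : ℝ :=
  (2 - α - n) ^ 2 / 4 + (Real.pi / Real.log (r₂ / r₁)) ^ 2

/-- The radial function `r^((2 - α - n)/2) sin((π / ln(r₂/r₁)) ln(r/r₁))`, `r = |x|`. -/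
def shellExtremal (𝕜 : Type*) [RCLike 𝕜] (n : ℕ) (α r₁ r₂ : ℝ)
    (x : EuclideanSpace ℝ (Fin n)) : 𝕜 :=
  ((‖x‖ ^ ((2 - α - n) / 2) *
    Real.sin (Real.pi / Real.log (r₂ / r₁) * Real.log (‖x‖ / r₁)) : ℝ) : 𝕜)

end

/-! ### Limits in `L²`. -/

section L2

variable {F : Type*} [NormedAddCommGroup F]

/-! The proof is a ground-state argument. Put `c = (2 - α - n)/2`, `κ = π / ln(r₂/r₁)` and `v(r) =
r^c sin(κ ln(r/r₁))`. This `v` is positive inside the shell, vanishes on its boundary and solves the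
Euler–Lagrange equation `div(|x|^α ∇v) = -(c² + κ²) |x|^(α-2) v`.

For a test function `φ`, write `g = r v'/v = c + κ cot(κ ln(r/r₁))`. Cauchy–Schwarz and completing
the square give `|x|² |∇φ|² ≥ g x·∇|φ|² - g² |φ|²`. After multiplication by `|x|^(α-2)`, the
divergence theorem for `|φ|² p(|x|) x` with `p = r^(α-2) g` removes the derivative of `|φ|²`, and
the Riccati equation for `g` leaves exactly `(c² + κ²) |x|^(α-2) |φ|²` (`hardy_of_isTestFunction`).
Since `r₁ > 0`, the weights are bounded on the shell, so the inequality passes to `W₀^{1,2}` limits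
(`hardy_of_memW012`).

For equality, smooth truncations of `v` at height `1/(k+1)` are test functions converging to `v` in
`W^{1,2}` (`memW012_shellProfile`). Testing the Euler–Lagrange equation with them and letting `k →
∞` gives equality for `v` (`integral_classicalGradient_shellProfile`). Optimality follows because
the right-hand integral of `v` is positive. -/

theorem MeasureTheory.eLpNorm_two_tendsto_zero_of_dominated {X : Type*} [MeasurableSpace X]
    {μ : Measure X} [IsFiniteMeasure μ] {u : ℕ → X → F} {M : ℝ}
    (hu : ∀ k, AEStronglyMeasurable (u k) μ) (hM : ∀ k, ∀ᵐ x ∂μ, ‖u k x‖ ≤ M)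
    (hlim : ∀ᵐ x ∂μ, Tendsto (fun k => u k x) atTop (𝓝 0)) :
    Tendsto (fun k => eLpNorm (u k) 2 μ) atTop (𝓝 0) := by
  have key : Tendsto (fun k => ∫⁻ x, ‖u k x‖ₑ ^ (2 : ℝ) ∂μ) atTop (𝓝 (∫⁻ _, 0 ∂μ)) := by
    refine tendsto_lintegral_of_dominated_convergence' (fun _ => ENNReal.ofReal M ^ (2 : ℝ))
      (fun k => (hu k).enorm.pow_const _) (fun k => ?_) ?_ ?_
    · filter_upwards [hM k] with x hx
      gcongr
      rw [← ofReal_norm]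
      exact ENNReal.ofReal_le_ofReal hx
    · rw [lintegral_const]
      exact ENNReal.mul_ne_top (by simp) (measure_ne_top _ _)
    · filter_upwards [hlim] with x hx
      have := (ENNReal.continuous_rpow_const (y := (2 : ℝ))).tendsto 0 |>.comp
        ((continuous_enorm.tendsto (0 : F)).comp hx |> fun h => by simpa using h)
      simpa [Function.comp_def] using this
  have := (ENNReal.continuous_rpow_const (y := (1 / 2 : ℝ))).tendsto _ |>.comp key
  simpa [eLpNorm_eq_lintegral_rpow_enorm_toReal, Function.comp_def] using this

theorem MeasureTheory.tendsto_integral_norm_sq {X : Type*} [MeasurableSpace X]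
    {μ : Measure X} {u : ℕ → X → F} {v : X → F} (hu : ∀ k, MemLp (u k) 2 μ) (hv : MemLp v 2 μ)
    (hlim : Tendsto (fun k => eLpNorm (fun x => u k x - v x) 2 μ) atTop (𝓝 0)) :
    Tendsto (fun k => ∫ x, ‖u k x‖ ^ 2 ∂μ) atTop (𝓝 (∫ x, ‖v x‖ ^ 2 ∂μ)) := by
  have h := (Lp.tendsto_Lp_iff_tendsto_eLpNorm'' u hu v hv).2 hlim
  have hn : ∀ {w : X → F} (hw : MemLp w 2 μ), ‖hw.toLp w‖ ^ 2 = ∫ x, ‖w x‖ ^ 2 ∂μ := by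
    intro w hw
    rw [Lp.norm_toLp, MemLp.eLpNorm_eq_integral_rpow_norm (by simp) (by simp) hw,
      ENNReal.toReal_ofReal (by positivity), ← Real.rpow_natCast, ← Real.rpow_mul (by positivity)]
    simp
  simpa only [hn] using (h.norm.pow 2)

end L2

/-! ### Integration by parts and weighted `L²` limits. -/

section General

variable {n : ℕ} {F : Type*} [NormedAddCommGroup F] [NormedSpace ℝ F]
  {Ω : Set (EuclideanSpace ℝ (Fin n))}

theorem integrable_smul_of_tsupport_subset {u : EuclideanSpace ℝ (Fin n) → ℝ}
    {k : EuclideanSpace ℝ (Fin n) → F} (hu : Continuous u) (hc : HasCompactSupport u)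
    (hsub : tsupport u ⊆ Ω) (hk : ContinuousOn k Ω) :
    Integrable (fun x => u x • k x) := by
  have h : IntegrableOn (fun x => u x • k x) (tsupport u) :=
    (hu.continuousOn.smul (hk.mono hsub)).integrableOn_compact hc
  refine (integrableOn_iff_integrable_of_support_subset ?_).1 h
  exact (Function.support_smul_subset_left _ _).trans (subset_tsupport _)

theorem tsupport_partialDeriv_subset (i : Fin n) (u : EuclideanSpace ℝ (Fin n) → F) :
    tsupport (partialDeriv i u) ⊆ tsupport u :=
  tsupport_fderiv_apply_subset ℝ _

theorem continuousOn_partialDeriv (hΩ : IsOpen Ω) {h : EuclideanSpace ℝ (Fin n) → F}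
    (hh : ContDiffOn ℝ 1 h Ω) (i : Fin n) : ContinuousOn (partialDeriv i h) Ω :=
  (hh.continuousOn_fderiv_of_isOpen hΩ le_rfl).clm_apply continuousOn_const

/-- Integration by parts against a compactly supported function, together with the integrability
of both products. -/
theorem integral_partialDeriv_smul_add (hΩ : IsOpen Ω) {u : EuclideanSpace ℝ (Fin n) → ℝ}
    {h : EuclideanSpace ℝ (Fin n) → F} (hu : ContDiff ℝ 1 u) (hc : HasCompactSupport u)
    (hsub : tsupport u ⊆ Ω) (hh : ContDiffOn ℝ 1 h Ω) (i : Fin n) :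
    IntegrableOn (fun x => partialDeriv i u x • h x) Ω ∧
    IntegrableOn (fun x => u x • partialDeriv i h x) Ω ∧
    ∫ x in Ω, partialDeriv i u x • h x = - ∫ x in Ω, u x • partialDeriv i h x := by
  have hs := tsupport_partialDeriv_subset i u
  have h1 : Integrable (fun x => partialDeriv i u x • h x) :=
    integrable_smul_of_tsupport_subset
      ((hu.continuous_fderiv one_ne_zero).clm_apply continuous_const)
      (hc.of_isClosed_subset (isClosed_tsupport _) hs) (hs.trans hsub) hh.continuousOn
  have h2 : Integrable (fun x => u x • partialDeriv i h x) :=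
    integrable_smul_of_tsupport_subset hu.continuous hc hsub (continuousOn_partialDeriv hΩ hh i)
  have h3 : Integrable (fun x => u x • h x) :=
    integrable_smul_of_tsupport_subset hu.continuous hc hsub hh.continuousOn
  refine ⟨h1.integrableOn, h2.integrableOn, ?_⟩
  -- Both products vanish off `Ω`, so integration by parts can be done on the whole space; `h` needs
  -- regularity only on `tsupport u`.
  rw [setIntegral_eq_integral_of_forall_compl_eq_zero,
    setIntegral_eq_integral_of_forall_compl_eq_zero]
  · have := integral_smul_fderiv_eq_neg_fderiv_smul_of_integrable (μ := volume)
      (v := EuclideanSpace.single i (1 : ℝ)) h1 h2 h3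
      (fun x _ => hu.differentiable one_ne_zero x)
      (fun x hx => (hh.differentiableOn one_ne_zero).differentiableAt (hΩ.mem_nhds (hsub hx)))
    rw [eq_neg_iff_add_eq_zero] at this ⊢
    rw [add_comm]
    exact this
  · intro x hx
    rw [image_eq_zero_of_notMem_tsupport (fun h => hx (hsub h)), zero_smul]
  · intro x hx
    rw [image_eq_zero_of_notMem_tsupport (fun h => hx (hsub (hs h))), zero_smul]

/-- Convergence in `L²` implies convergence of the weighted `L²` norms, for a bounded weight. -/
theorem MeasureTheory.tendsto_integral_mul_norm_sq {X : Type*} [MeasurableSpace X]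
    {μ : Measure X} {u : ℕ → X → F} {v : X → F} (hu : ∀ k, MemLp (u k) 2 μ) (hv : MemLp v 2 μ)
    (hlim : Tendsto (fun k => eLpNorm (fun x => u k x - v x) 2 μ) atTop (𝓝 0))
    {w : X → ℝ} {M : ℝ} (hw : AEStronglyMeasurable w μ) (hw0 : ∀ᵐ x ∂μ, 0 ≤ w x)
    (hM : ∀ᵐ x ∂μ, w x ≤ M) :
    Tendsto (fun k => ∫ x, w x * ‖u k x‖ ^ 2 ∂μ) atTop (𝓝 (∫ x, w x * ‖v x‖ ^ 2 ∂μ)) := by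
  -- Multiplication by `√w` is bounded on `L²` and turns the weighted norm into the plain one.
  have hs : AEStronglyMeasurable (fun x => √(w x)) μ :=
    Real.continuous_sqrt.comp_aestronglyMeasurable hw
  have hb : ∀ (g : X → F), ∀ᵐ x ∂μ, ‖√(w x) • g x‖ ≤ √M * ‖g x‖ := by
    intro g
    filter_upwards [hM] with x hx
    rw [norm_smul, Real.norm_of_nonneg (Real.sqrt_nonneg _)]
    gcongr
  have hmem : ∀ {g : X → F}, MemLp g 2 μ → MemLp (fun x => √(w x) • g x) 2 μ := fun {g} hg =>
    hg.of_le_mul (hs.smul hg.1) (hb g)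
  have heq : ∀ (g : X → F), ∫ x, ‖√(w x) • g x‖ ^ 2 ∂μ = ∫ x, w x * ‖g x‖ ^ 2 ∂μ := by
    intro g
    refine integral_congr_ae ?_
    filter_upwards [hw0] with x hx
    rw [norm_smul, mul_pow, Real.norm_of_nonneg (Real.sqrt_nonneg _), Real.sq_sqrt hx]
  have := tendsto_integral_norm_sq (fun k => hmem (hu k)) (hmem hv) ?_
  · simpa only [heq] using this
  · have hup := ENNReal.Tendsto.const_mul (a := ENNReal.ofReal √M) hlim
      (Or.inr ENNReal.ofReal_ne_top)
    rw [mul_zero] at hup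
    refine tendsto_of_tendsto_of_tendsto_of_le_of_le tendsto_const_nhds hup
      (fun _ => zero_le) (fun k => ?_)
    refine eLpNorm_le_mul_eLpNorm_of_ae_le_mul ?_ 2
    filter_upwards [hb (fun x => u k x - v x)] with x hx
    simpa only [smul_sub] using hx

end General

/-! ### Classical versus weak gradients, and uniqueness. -/

section WeakGradient

variable {n : ℕ} {𝕜 : Type*} [RCLike 𝕜] {Ω : Set (EuclideanSpace ℝ (Fin n))}

theorem continuousOn_classicalGradient (hΩ : IsOpen Ω) {f : EuclideanSpace ℝ (Fin n) → 𝕜}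
    (hf : ContDiffOn ℝ 1 f Ω) : ContinuousOn (classicalGradient f) Ω :=
  (PiLp.continuous_toLp 2 _).comp_continuousOn
    (continuousOn_pi.2 fun i => continuousOn_partialDeriv hΩ hf i)

/-- The classical gradient of a `C¹` function is its weak gradient. -/
theorem ContDiffOn.hasWeakGradient (hΩ : IsOpen Ω) {f : EuclideanSpace ℝ (Fin n) → 𝕜}
    (hf : ContDiffOn ℝ 1 f Ω) : HasWeakGradient Ω f (classicalGradient f) where
  locallyIntegrableOn := hf.continuousOn.locallyIntegrableOn hΩ.measurableSet
  locallyIntegrableOn_gradient :=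
    (continuousOn_classicalGradient hΩ hf).locallyIntegrableOn hΩ.measurableSet
  integral_eq φ hφ i := (integral_partialDeriv_smul_add hΩ (hφ.contDiff.of_le (by simp))
    hφ.hasCompactSupport hφ.tsupport_subset hf i).2.2

/-- The weak gradient is unique up to null sets. -/
theorem HasWeakGradient.ae_eq (hΩ : IsOpen Ω) {f : EuclideanSpace ℝ (Fin n) → 𝕜}
    {G G' : EuclideanSpace ℝ (Fin n) → EuclideanSpace 𝕜 (Fin n)}
    (h : HasWeakGradient Ω f G) (h' : HasWeakGradient Ω f G') :
    G =ᵐ[volume.restrict Ω] G' := by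
  have hcomp : ∀ {H : EuclideanSpace ℝ (Fin n) → EuclideanSpace 𝕜 (Fin n)} (i : Fin n),
      LocallyIntegrableOn H Ω → LocallyIntegrableOn (fun x => H x i) Ω := by
    intro H i hH x hx
    obtain ⟨s, hs, hi⟩ := hH x hx
    exact ⟨s, hs, (EuclideanSpace.proj (𝕜 := 𝕜) i).integrable_comp hi⟩
  have hae : ∀ i : Fin n, ∀ᵐ x, x ∈ Ω → G x i - G' x i = 0 := by
    intro i
    have hG := hcomp i h.locallyIntegrableOn_gradient
    have hG' := hcomp i h'.locallyIntegrableOn_gradient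
    -- The fundamental lemma of the calculus of variations, one coordinate at a time.
    refine hΩ.ae_eq_zero_of_integral_contDiff_smul_eq_zero (hG.sub hG') fun φ hφ hc hs => ?_
    have hi : ∀ {g : EuclideanSpace ℝ (Fin n) → 𝕜}, LocallyIntegrableOn g Ω →
        Integrable (fun x => φ x • g x) := by
      intro g hg
      have hK := (hg.integrableOn_compact_subset hs hc).continuousOn_smul
        hφ.continuous.continuousOn hc
      exact (integrableOn_iff_integrable_of_support_subset
        ((Function.support_smul_subset_left _ _).trans (subset_tsupport _))).1 hK
    have hset : ∀ g : EuclideanSpace ℝ (Fin n) → 𝕜,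
        ∫ x in Ω, φ x • g x = ∫ x, φ x • g x := fun g =>
      setIntegral_eq_integral_of_forall_compl_eq_zero fun x hx => by
        rw [image_eq_zero_of_notMem_tsupport (fun h => hx (hs h)), zero_smul]
    have e := (h.integral_eq φ ⟨hφ, hc, hs⟩ i).symm.trans (h'.integral_eq φ ⟨hφ, hc, hs⟩ i)
    rw [neg_inj, hset (fun x => G x i), hset (fun x => G' x i)] at e
    simp only [smul_sub]
    rw [integral_sub (hi hG) (hi hG'), e, sub_self]
  filter_upwards [ae_restrict_mem hΩ.measurableSet,
    ae_restrict_of_ae (ae_all_iff.2 hae)] with x hx hall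
  ext i
  exact sub_eq_zero.1 (hall i hx)

end WeakGradient

/-! ### Radial calculus and power weights on the shell. -/

section Radial

variable {n : ℕ} {𝕜 : Type*} [RCLike 𝕜]

theorem isOpen_sphericalShell (n : ℕ) (r₁ r₂ : ℝ) : IsOpen (sphericalShell n r₁ r₂) :=
  (isOpen_lt continuous_const continuous_norm).inter (isOpen_lt continuous_norm continuous_const)

theorem isBounded_sphericalShell (n : ℕ) (r₁ r₂ : ℝ) :
    Bornology.IsBounded (sphericalShell n r₁ r₂) :=
  isBounded_iff_forall_norm_le.2 ⟨r₂, fun _ hx => hx.2.le⟩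

theorem ne_zero_of_mem_sphericalShell {r₁ r₂ : ℝ} (hr₁ : 0 ≤ r₁)
    {x : EuclideanSpace ℝ (Fin n)} (hx : x ∈ sphericalShell n r₁ r₂) : x ≠ 0 :=
  norm_pos_iff.1 (hr₁.trans_lt hx.1)

instance isFiniteMeasure_restrict_sphericalShell (n : ℕ) (r₁ r₂ : ℝ) :
    IsFiniteMeasure (volume.restrict (sphericalShell n r₁ r₂)) :=
  ⟨by simpa using (isBounded_sphericalShell n r₁ r₂).measure_lt_top⟩

theorem hasFDerivAt_norm_of_ne_zero {E : Type*} [NormedAddCommGroup E] [InnerProductSpace ℝ E]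
    {x : E} (hx : x ≠ 0) : HasFDerivAt (fun y : E => ‖y‖) (‖x‖⁻¹ • innerSL ℝ x) x := by
  have h := (hasStrictFDerivAt_norm_sq x).hasFDerivAt.sqrt (by positivity)
  simp only [Real.sqrt_sq (norm_nonneg _)] at h
  convert h using 1
  rw [← Nat.cast_smul_eq_nsmul ℝ, smul_smul]
  congr 1
  have := norm_ne_zero_iff.2 hx
  push_cast
  field_simp

theorem inner_single_one (x : EuclideanSpace ℝ (Fin n)) (i : Fin n) :
    inner ℝ x (EuclideanSpace.single i (1 : ℝ)) = x i := by
  simp [EuclideanSpace.inner_single_right]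

theorem partialDeriv_radial {F : Type*} [NormedAddCommGroup F] [NormedSpace ℝ F] {p : ℝ → F}
    {p' : F} {x : EuclideanSpace ℝ (Fin n)}
    (hx : x ≠ 0) (hp : HasDerivAt p p' ‖x‖) (i : Fin n) :
    partialDeriv i (fun y => p ‖y‖) x = (x i / ‖x‖) • p' := by
  have h := hp.hasFDerivAt.comp x (hasFDerivAt_norm_of_ne_zero hx)
  rw [partialDeriv, show (fun y : EuclideanSpace ℝ (Fin n) => p ‖y‖) = p ∘ fun y => ‖y‖ from rfl,
    h.fderiv]
  simp [inner_single_one, div_eq_inv_mul, mul_smul]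

theorem partialDeriv_radial_mul_apply {p : ℝ → ℝ} {p' : ℝ} {x : EuclideanSpace ℝ (Fin n)}
    (hx : x ≠ 0) (hp : HasDerivAt p p' ‖x‖) (i : Fin n) :
    partialDeriv i (fun y => p ‖y‖ * y i) x = p' * x i ^ 2 / ‖x‖ + p ‖x‖ := by
  have h := hp.hasFDerivAt.comp x (hasFDerivAt_norm_of_ne_zero hx)
  have h2 := h.mul (EuclideanSpace.proj (𝕜 := ℝ) i : EuclideanSpace ℝ (Fin n) →L[ℝ] ℝ).hasFDerivAt (x := x)
  have : partialDeriv i (fun y => p ‖y‖ * y i) x = _ :=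
    congrArg (fun L => L (EuclideanSpace.single i (1 : ℝ))) h2.fderiv
  rw [this]
  simp [inner_single_one]
  ring

theorem classicalGradient_radial {p : ℝ → ℝ} {p' : ℝ} {x : EuclideanSpace ℝ (Fin n)}
    (hx : x ≠ 0) (hp : HasDerivAt p p' ‖x‖) :
    classicalGradient (fun y => ((p ‖y‖ : ℝ) : 𝕜)) x =
      WithLp.toLp 2 fun i => ((x i / ‖x‖ * p' : ℝ) : 𝕜) := by
  unfold classicalGradient
  congr 1
  ext i
  have := (RCLike.ofRealCLM (K := 𝕜)).hasFDerivAt.comp_hasDerivAt _ hp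
  refine (partialDeriv_radial hx this i).trans ?_
  simp [RCLike.real_smul_eq_coe_mul]

/-- The vector is `a` times the unit vector `x/|x|`. -/
theorem norm_toLp_radial {x : EuclideanSpace ℝ (Fin n)} (hx : x ≠ 0) (a : ℝ) :
    ‖(WithLp.toLp 2 fun i => ((x i / ‖x‖ * a : ℝ) : 𝕜) : EuclideanSpace 𝕜 (Fin n))‖ = |a| := by
  have h0 := norm_ne_zero_iff.2 hx
  rw [EuclideanSpace.norm_eq, ← Real.sqrt_sq_eq_abs]
  congr 1
  have := EuclideanSpace.real_norm_sq_eq x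
  simp only [RCLike.norm_ofReal, sq_abs, mul_pow, div_pow, ← Finset.sum_mul, ← Finset.sum_div,
    ← this]
  field_simp

theorem contDiffOn_radial {F : Type*} [NormedAddCommGroup F] [NormedSpace ℝ F] {p : ℝ → F}
    {m : WithTop ℕ∞} {r₁ r₂ : ℝ} (hr₁ : 0 ≤ r₁) (hp : ContDiffOn ℝ m p (Set.Ioo r₁ r₂)) :
    ContDiffOn ℝ m (fun x : EuclideanSpace ℝ (Fin n) => p ‖x‖) (sphericalShell n r₁ r₂) :=
  hp.comp (fun _ hx => (contDiffAt_norm ℝ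
    (ne_zero_of_mem_sphericalShell hr₁ hx)).contDiffWithinAt) fun _ hx => hx

/-- The divergence theorem for the field `u(x) p(|x|) x`, with `u` compactly supported in the
shell. -/
theorem integral_div_radial {r₁ r₂ : ℝ} (hr₁ : 0 ≤ r₁) {p : ℝ → ℝ}
    (hp : ContDiffOn ℝ 1 p (Set.Ioo r₁ r₂)) {u : EuclideanSpace ℝ (Fin n) → ℝ}
    (hu : ContDiff ℝ 1 u) (hc : HasCompactSupport u)
    (hsub : tsupport u ⊆ sphericalShell n r₁ r₂) :
    IntegrableOn (fun x => p ‖x‖ * ∑ i, x i * partialDeriv i u x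
      + (n * p ‖x‖ + ‖x‖ * deriv p ‖x‖) * u x) (sphericalShell n r₁ r₂) ∧
    ∫ x in sphericalShell n r₁ r₂, (p ‖x‖ * ∑ i, x i * partialDeriv i u x
      + (n * p ‖x‖ + ‖x‖ * deriv p ‖x‖) * u x) = 0 := by
  set Ω := sphericalShell n r₁ r₂
  have hΩ : IsOpen Ω := isOpen_sphericalShell n r₁ r₂
  have hh : ∀ i : Fin n, ContDiffOn ℝ 1
      (fun x : EuclideanSpace ℝ (Fin n) => p ‖x‖ * x i) Ω := fun i =>
    (contDiffOn_radial hr₁ hp).mul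
      (EuclideanSpace.proj (𝕜 := ℝ) i : EuclideanSpace ℝ (Fin n) →L[ℝ] ℝ).contDiff.contDiffOn
  have hI := fun i => integral_partialDeriv_smul_add hΩ hu hc hsub (hh i) i
  -- Product rule for the divergence of `u p(|x|) x`: since `∑ xᵢ² = |x|²`, the field `p(|x|) x` has
  -- divergence `n p + |x| p'`.
  have hsum : Set.EqOn (fun x => ∑ i : Fin n, (partialDeriv i u x • (p ‖x‖ * x i)
      + u x • partialDeriv i (fun y => p ‖y‖ * y i) x))
      (fun x => p ‖x‖ * ∑ i, x i * partialDeriv i u x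
      + (n * p ‖x‖ + ‖x‖ * deriv p ‖x‖) * u x) Ω := by
    intro x hx
    have hx0 := ne_zero_of_mem_sphericalShell hr₁ hx
    have hd : HasDerivAt p (deriv p ‖x‖) ‖x‖ :=
      ((hp.differentiableOn one_ne_zero).differentiableAt
        (isOpen_Ioo.mem_nhds hx)).hasDerivAt
    have hnorm := EuclideanSpace.real_norm_sq_eq x
    have h0 := norm_ne_zero_iff.2 hx0
    simp only [partialDeriv_radial_mul_apply hx0 hd, smul_eq_mul]
    rw [Finset.sum_add_distrib, ← Finset.mul_sum, Finset.sum_add_distrib, ← Finset.sum_div,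
      ← Finset.mul_sum, ← hnorm, Finset.mul_sum]
    simp only [Finset.sum_const, Finset.card_univ, Fintype.card_fin, nsmul_eq_mul]
    congr 1
    · exact Finset.sum_congr rfl fun i _ => by ring
    · field_simp
      ring
  have hint := integrable_finsetSum Finset.univ fun i _ => (hI i).1.add (hI i).2.1
  refine ⟨IntegrableOn.congr_fun ?_ hsum hΩ.measurableSet, ?_⟩
  · simpa [IntegrableOn, Finset.sum_apply] using hint
  · rw [← setIntegral_congr_fun hΩ.measurableSet hsum, integral_finsetSum]
    · refine Finset.sum_eq_zero fun i _ => ?_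
      rw [integral_add (hI i).1 (hI i).2.1, (hI i).2.2, neg_add_cancel]
    · exact fun i _ => (hI i).1.add (hI i).2.1

/-- A power is monotone, so one endpoint value dominates; adding both gives a bound independent of
the sign of `β`. -/
theorem norm_rpow_le_of_mem_sphericalShell {r₁ r₂ : ℝ} (hr₁ : 0 < r₁) (β : ℝ)
    {x : EuclideanSpace ℝ (Fin n)} (hx : x ∈ sphericalShell n r₁ r₂) :
    ‖x‖ ^ β ≤ r₁ ^ β + r₂ ^ β := by
  have h0 : 0 < ‖x‖ := hr₁.trans hx.1
  have h2 : 0 < r₂ := h0.trans hx.2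
  rcases le_total 0 β with hβ | hβ
  · have := Real.rpow_le_rpow h0.le hx.2.le hβ
    have := Real.rpow_nonneg hr₁.le β
    linarith
  · have := Real.rpow_le_rpow_of_nonpos hr₁ hx.1.le hβ
    have := Real.rpow_nonneg h2.le β
    linarith

theorem aestronglyMeasurable_norm_rpow (β : ℝ) (μ : Measure (EuclideanSpace ℝ (Fin n))) :
    AEStronglyMeasurable (fun x => ‖x‖ ^ β) μ :=
  (measurable_norm.pow_const β).aestronglyMeasurable

theorem integrableOn_norm_rpow_mul_norm_sq {r₁ r₂ : ℝ} (hr₁ : 0 < r₁) (β : ℝ) {F : Type*}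
    [NormedAddCommGroup F] {u : EuclideanSpace ℝ (Fin n) → F}
    (hu : MemLp u 2 (volume.restrict (sphericalShell n r₁ r₂))) :
    IntegrableOn (fun x => ‖x‖ ^ β * ‖u x‖ ^ 2) (sphericalShell n r₁ r₂) := by
  have h : Integrable (fun x => ‖u x‖ ^ 2) (volume.restrict (sphericalShell n r₁ r₂)) :=
    (memLp_two_iff_integrable_sq_norm hu.1).1 hu
  refine Integrable.bdd_mul (c := r₁ ^ β + r₂ ^ β) h (aestronglyMeasurable_norm_rpow β _) ?_
  filter_upwards [ae_restrict_mem (isOpen_sphericalShell n r₁ r₂).measurableSet] with x hx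
  rw [Real.norm_of_nonneg (by positivity)]
  exact norm_rpow_le_of_mem_sphericalShell hr₁ β hx

theorem tendsto_integral_norm_rpow_mul_norm_sq {r₁ r₂ : ℝ} (hr₁ : 0 < r₁) (β : ℝ) {F : Type*}
    [NormedAddCommGroup F] [NormedSpace ℝ F] {u : ℕ → EuclideanSpace ℝ (Fin n) → F}
    {v : EuclideanSpace ℝ (Fin n) → F}
    (hu : ∀ k, MemLp (u k) 2 (volume.restrict (sphericalShell n r₁ r₂)))
    (hv : MemLp v 2 (volume.restrict (sphericalShell n r₁ r₂)))
    (hlim : Tendsto (fun k => eLpNorm (fun x => u k x - v x) 2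
      (volume.restrict (sphericalShell n r₁ r₂))) atTop (𝓝 0)) :
    Tendsto (fun k => ∫ x in sphericalShell n r₁ r₂, ‖x‖ ^ β * ‖u k x‖ ^ 2) atTop
      (𝓝 (∫ x in sphericalShell n r₁ r₂, ‖x‖ ^ β * ‖v x‖ ^ 2)) := by
  refine tendsto_integral_mul_norm_sq hu hv hlim (M := r₁ ^ β + r₂ ^ β)
    (aestronglyMeasurable_norm_rpow β _) (.of_forall fun x => by positivity) ?_
  filter_upwards [ae_restrict_mem (isOpen_sphericalShell n r₁ r₂).measurableSet] with x hx
  exact norm_rpow_le_of_mem_sphericalShell hr₁ β hx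

end Radial

/-! ### Test functions and their radial derivatives. -/

section TestFunction

variable {n : ℕ} {𝕜 : Type*} [RCLike 𝕜] {Ω : Set (EuclideanSpace ℝ (Fin n))}

theorem IsTestFunction.memLp {φ : EuclideanSpace ℝ (Fin n) → 𝕜} (hφ : IsTestFunction Ω φ) :
    MemLp φ 2 (volume.restrict Ω) :=
  (hφ.contDiff.continuous.memLp_of_hasCompactSupport hφ.hasCompactSupport).restrict Ω

theorem IsTestFunction.continuous_classicalGradient {φ : EuclideanSpace ℝ (Fin n) → 𝕜}
    (hφ : IsTestFunction Ω φ) : Continuous (classicalGradient φ) :=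
  continuousOn_univ.1 (continuousOn_classicalGradient isOpen_univ
    (hφ.contDiff.of_le (by simp)).contDiffOn)

theorem IsTestFunction.memLp_classicalGradient {φ : EuclideanSpace ℝ (Fin n) → 𝕜}
    (hφ : IsTestFunction Ω φ) : MemLp (classicalGradient φ) 2 (volume.restrict Ω) := by
  refine (hφ.continuous_classicalGradient.memLp_of_hasCompactSupport ?_).restrict Ω
  refine HasCompactSupport.intro hφ.hasCompactSupport fun x hx => ?_
  ext i
  exact image_eq_zero_of_notMem_tsupport (f := partialDeriv i φ) fun h => hx (tsupport_partialDeriv_subset i φ h)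

/-- The Cauchy–Schwarz bound of the radial derivative by the gradient. -/
theorem norm_sum_mul_partialDeriv_le (φ : EuclideanSpace ℝ (Fin n) → 𝕜)
    (x : EuclideanSpace ℝ (Fin n)) :
    ‖∑ i, (x i : 𝕜) * partialDeriv i φ x‖ ≤ ‖x‖ * ‖classicalGradient φ x‖ := by
  set y : EuclideanSpace 𝕜 (Fin n) := WithLp.toLp 2 fun i => (x i : 𝕜)
  have hy : ‖y‖ = ‖x‖ := by simp [y, EuclideanSpace.norm_eq]
  have h := norm_inner_le_norm (𝕜 := 𝕜) y (classicalGradient φ x)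
  rw [hy] at h
  simpa [PiLp.inner_apply, y, classicalGradient, RCLike.inner_apply, mul_comm] using h

theorem partialDeriv_norm_sq {φ : EuclideanSpace ℝ (Fin n) → 𝕜}
    {x : EuclideanSpace ℝ (Fin n)} (hφ : DifferentiableAt ℝ φ x) (i : Fin n) :
    partialDeriv i (fun y => ‖φ y‖ ^ 2) x
      = 2 * RCLike.re ((starRingEnd 𝕜) (φ x) * partialDeriv i φ x) := by
  have h := hφ.hasFDerivAt.norm_sq
  rw [partialDeriv, h.fderiv]
  have e : ∀ a b : 𝕜, inner ℝ a b = RCLike.re (b * (starRingEnd 𝕜) a) := fun _ _ => rfl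
  simp [partialDeriv, e, mul_comm, mul_add]

end TestFunction

/-! ### The inequality, for test functions and then on `W₀^{1,2}`. -/

section Inequality

variable {n : ℕ} {𝕜 : Type*} [RCLike 𝕜]

theorem hasDerivAt_const_mul_log_div (κ : ℝ) {r₁ r : ℝ} (hr₁ : 0 < r₁) (hr : 0 < r) :
    HasDerivAt (fun s => κ * Real.log (s / r₁)) (κ / r) r := by
  refine ((((hasDerivAt_id r).div_const r₁).log (div_pos hr hr₁).ne').const_mul κ).congr_deriv ?_
  simp only [id_eq]
  field_simp

/-- This makes the ground state positive, hence its logarithmic derivative smooth, inside the shell.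
-/
theorem shell_angle_mem_Ioo {r₁ r₂ r : ℝ} (hr₁ : 0 < r₁) (hr : r ∈ Set.Ioo r₁ r₂) :
    Real.pi / Real.log (r₂ / r₁) * Real.log (r / r₁) ∈ Set.Ioo 0 Real.pi := by
  have h1 : 0 < Real.log (r / r₁) := Real.log_pos ((one_lt_div hr₁).2 hr.1)
  have h2 : Real.log (r / r₁) < Real.log (r₂ / r₁) :=
    Real.log_lt_log (div_pos (hr₁.trans hr.1) hr₁) (by gcongr; exact hr.2)
  have h3 : 0 < Real.log (r₂ / r₁) := h1.trans h2
  have hpi := Real.pi_pos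
  refine ⟨by positivity, ?_⟩
  rw [div_mul_eq_mul_div, div_lt_iff₀ h3]
  gcongr

/-- Completing the square: `|z|² ≥ 2 g Re(z̄ w) - g² |w|²`. -/
theorem two_mul_re_sub_le_norm_sq (z w : 𝕜) (g : ℝ) :
    g * (2 * RCLike.re ((starRingEnd 𝕜) w * z)) - g ^ 2 * ‖w‖ ^ 2 ≤ ‖z‖ ^ 2 := by
  rw [← RCLike.normSq_eq_def', ← RCLike.normSq_eq_def', RCLike.normSq_apply, RCLike.normSq_apply,
    RCLike.mul_re]
  simp only [RCLike.conj_re, RCLike.conj_im]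
  nlinarith [sq_nonneg (RCLike.re z - g * RCLike.re w), sq_nonneg (RCLike.im z - g * RCLike.im w)]

/-- Writing the derivative of the cotangent as `-(1 + cot²)` keeps the result polynomial in `cot`,
as the Riccati identity requires. -/
theorem hasDerivAt_rpow_mul_cot (a c κ : ℝ) {r₁ r : ℝ} (hr₁ : 0 < r₁) (hr : 0 < r)
    (hs : Real.sin (κ * Real.log (r / r₁)) ≠ 0) :
    HasDerivAt (fun s => s ^ a * (c + κ * (Real.cos (κ * Real.log (s / r₁)) /
        Real.sin (κ * Real.log (s / r₁)))))
      (r ^ a * (a * (c + κ * (Real.cos (κ * Real.log (r / r₁)) /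
        Real.sin (κ * Real.log (r / r₁)))) - κ ^ 2 * (1 + (Real.cos (κ * Real.log (r / r₁)) /
        Real.sin (κ * Real.log (r / r₁))) ^ 2)) / r) r := by
  have hθ := hasDerivAt_const_mul_log_div κ hr₁ hr
  have h := (Real.hasDerivAt_rpow_const (p := a) (Or.inl hr.ne')).mul
    (((hθ.cos.div hθ.sin hs).const_mul κ).const_add c)
  refine h.congr_deriv ?_
  rw [Real.rpow_sub_one hr.ne']
  simp only [Pi.div_apply]
  field_simp
  ring

/-- The inequality for test functions, by completing the square with the logarithmic derivative of
the ground state. -/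
theorem hardy_of_isTestFunction (α : ℝ) {r₁ r₂ : ℝ} (hr₁ : 0 < r₁)
    {φ : EuclideanSpace ℝ (Fin n) → 𝕜} (hφ : IsTestFunction (sphericalShell n r₁ r₂) φ) :
    shellHardyConst n α r₁ r₂ * ∫ x in sphericalShell n r₁ r₂, ‖x‖ ^ (α - 2) * ‖φ x‖ ^ 2 ≤
      ∫ x in sphericalShell n r₁ r₂, ‖x‖ ^ α * ‖classicalGradient φ x‖ ^ 2 := by
  set κ : ℝ := Real.pi / Real.log (r₂ / r₁) with hκ
  set c : ℝ := (2 - α - n) / 2 with hc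
  -- Chosen so that `p(|x|) x = |x|^α ∇v / v` for the ground state `v`. It is singular at `r₁` and
  -- `r₂`, which is harmless as `φ` has compact support in the open shell.
  set p : ℝ → ℝ := fun s => s ^ (α - 2) * (c + κ * (Real.cos (κ * Real.log (s / r₁)) /
        Real.sin (κ * Real.log (s / r₁)))) with hp
  have hsin : ∀ r ∈ Set.Ioo r₁ r₂, Real.sin (κ * Real.log (r / r₁)) ≠ 0 := fun r hr =>
    (Real.sin_pos_of_mem_Ioo (shell_angle_mem_Ioo hr₁ hr)).ne'
  have hpC : ContDiffOn ℝ 1 p (Set.Ioo r₁ r₂) := by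
    intro r hr
    have hr0 : 0 < r := hr₁.trans hr.1
    have hθ : ContDiffAt ℝ 1 (fun s => κ * Real.log (s / r₁)) r :=
      contDiffAt_const.mul ((contDiffAt_id.div_const r₁).log (div_pos hr0 hr₁).ne')
    exact ((Real.contDiffAt_rpow_const (Or.inl hr0.ne')).mul (contDiffAt_const.add
      (contDiffAt_const.mul (hθ.cos.div hθ.sin (hsin r hr))))).contDiffWithinAt
  have hu : ContDiff ℝ 1 fun x => ‖φ x‖ ^ 2 := (hφ.contDiff.of_le (by simp)).norm_sq ℝ
  have hts : tsupport (fun x => ‖φ x‖ ^ 2) ⊆ tsupport φ :=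
    closure_mono fun x hx h => hx (by simp [h])
  obtain ⟨hI, h0⟩ := integral_div_radial hr₁.le hpC hu
    (hφ.hasCompactSupport.of_isClosed_subset (isClosed_tsupport _) hts)
    (hts.trans hφ.tsupport_subset)
  have hI1 := integrableOn_norm_rpow_mul_norm_sq hr₁ (α - 2) hφ.memLp
  have hI2 := integrableOn_norm_rpow_mul_norm_sq hr₁ α hφ.memLp_classicalGradient
  -- Replacing `0` by the vanishing integral of a divergence leaves a pointwise inequality to prove.
  rw [← sub_nonneg, ← integral_const_mul, ← integral_sub hI2 (hI1.const_mul _), ← h0]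
  refine setIntegral_mono_on hI (hI2.sub (hI1.const_mul _))
    (isOpen_sphericalShell n r₁ r₂).measurableSet fun x hx => ?_
  have hr0 : 0 < ‖x‖ := hr₁.trans hx.1
  have hd := hasDerivAt_rpow_mul_cot (α - 2) c κ hr₁ hr0 (hsin _ hx)
  rw [hd.deriv]
  set t := Real.cos (κ * Real.log (‖x‖ / r₁)) / Real.sin (κ * Real.log (‖x‖ / r₁)) with ht
  have hS : ∑ i, x i * partialDeriv i (fun y => ‖φ y‖ ^ 2) x
      = 2 * RCLike.re ((starRingEnd 𝕜) (φ x) * ∑ i, (x i : 𝕜) * partialDeriv i φ x) := by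
    simp only [partialDeriv_norm_sq (hφ.contDiff.differentiable (by simp) x), Finset.mul_sum,
      map_sum]
    refine Finset.sum_congr rfl fun i _ => ?_
    rw [mul_left_comm ((starRingEnd 𝕜) (φ x)), RCLike.re_ofReal_mul]
    ring
  have hCS := norm_sum_mul_partialDeriv_le φ x
  have hsq := two_mul_re_sub_le_norm_sq (∑ i, (x i : 𝕜) * partialDeriv i φ x) (φ x) (c + κ * t)
  rw [← hS] at hsq
  have hCS2 := pow_le_pow_left₀ (norm_nonneg _) hCS 2
  have hw : ‖x‖ ^ α = ‖x‖ ^ (α - 2) * ‖x‖ ^ 2 := by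
    rw [← Real.rpow_natCast, ← Real.rpow_add hr0]
    norm_num
  have hn : (n : ℝ) = 2 - α - 2 * c := by rw [hc]; ring
  have hK : shellHardyConst n α r₁ r₂ = c ^ 2 + κ ^ 2 := by
    rw [shellHardyConst, hc, hκ]; ring
  rw [hw, hK, hp]
  simp only
  -- With `n = 2 - α - 2c` and `g = c + κ t`, the Riccati identity is `2 c g + κ² (1 + t²) - g² = c²
  -- + κ²`.
  rw [← ht, hn, mul_div_cancel₀ _ hr0.ne']
  have hw0 : 0 ≤ ‖x‖ ^ (α - 2) := by positivity
  have := mul_le_mul_of_nonneg_left (hsq.trans hCS2) hw0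
  nlinarith [this]

/-- The weighted inequality on the spherical shell for `W₀^{1,2}` functions. -/
theorem hardy_of_memW012 (α : ℝ) {r₁ r₂ : ℝ} (hr₁ : 0 < r₁)
    {f : EuclideanSpace ℝ (Fin n) → 𝕜}
    {G : EuclideanSpace ℝ (Fin n) → EuclideanSpace 𝕜 (Fin n)}
    (hf : MemW012 (sphericalShell n r₁ r₂) f) (hG : HasWeakGradient (sphericalShell n r₁ r₂) f G) :
    IntegrableOn (fun x => ‖x‖ ^ α * ‖G x‖ ^ 2) (sphericalShell n r₁ r₂) ∧
    IntegrableOn (fun x => ‖x‖ ^ (α - 2) * ‖f x‖ ^ 2) (sphericalShell n r₁ r₂) ∧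
    shellHardyConst n α r₁ r₂ * ∫ x in sphericalShell n r₁ r₂, ‖x‖ ^ (α - 2) * ‖f x‖ ^ 2 ≤
      ∫ x in sphericalShell n r₁ r₂, ‖x‖ ^ α * ‖G x‖ ^ 2 := by
  obtain ⟨hf2, G', hG', hG'2, φ, hφ, hlim, hlimG⟩ := hf
  have hae := hG'.ae_eq (isOpen_sphericalShell n r₁ r₂) hG
  have hG2 := hG'2.ae_eq hae
  refine ⟨integrableOn_norm_rpow_mul_norm_sq hr₁ α hG2,
    integrableOn_norm_rpow_mul_norm_sq hr₁ (α - 2) hf2, ?_⟩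
  have h1 := (tendsto_integral_norm_rpow_mul_norm_sq hr₁ (α - 2)
    (fun k => (hφ k).memLp) hf2 hlim).const_mul (shellHardyConst n α r₁ r₂)
  have h2 := tendsto_integral_norm_rpow_mul_norm_sq hr₁ α
    (fun k => (hφ k).memLp_classicalGradient) hG'2 hlimG
  refine (le_of_tendsto_of_tendsto' h1 h2 fun k => hardy_of_isTestFunction α hr₁ (hφ k)).trans_eq ?_
  refine integral_congr_ae ?_
  filter_upwards [hae] with x hx
  rw [hx]

end Inequality

/-! ### A smooth truncation of the real line. -/

noncomputable section Truncation

/-- A smooth function that vanishes on `(-∞, 1]` and is the identity on `[2, ∞)`. -/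
def smoothTrunc (t : ℝ) : ℝ := t * Real.smoothTransition (t - 1)

theorem contDiff_smoothTrunc : ContDiff ℝ ∞ smoothTrunc :=
  contDiff_id.mul (Real.smoothTransition.contDiff.comp (contDiff_id.sub contDiff_const))

theorem smoothTrunc_of_le_one {t : ℝ} (ht : t ≤ 1) : smoothTrunc t = 0 := by
  rw [smoothTrunc, Real.smoothTransition.zero_of_nonpos (by linarith), mul_zero]

theorem smoothTrunc_of_two_le {t : ℝ} (ht : 2 ≤ t) : smoothTrunc t = t := by
  rw [smoothTrunc, Real.smoothTransition.one_of_one_le (by linarith), mul_one]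

theorem abs_smoothTrunc_le (t : ℝ) : |smoothTrunc t| ≤ |t| := by
  rw [smoothTrunc, abs_mul, abs_of_nonneg (Real.smoothTransition.nonneg _)]
  exact mul_le_of_le_one_right (abs_nonneg t) (Real.smoothTransition.le_one _)

theorem deriv_smoothTrunc_of_two_lt {t : ℝ} (ht : 2 < t) : deriv smoothTrunc t = 1 := by
  have : smoothTrunc =ᶠ[𝓝 t] id := by
    filter_upwards [lt_mem_nhds ht] with s hs using smoothTrunc_of_two_le hs.le
  rw [this.deriv_eq, deriv_id]

/-- The derivative is `0` below `1`, `1` above `2`, and bounded on the compact interval between. In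
`shellTrunc` the factor `k + 1` cancels, so `B` dominates uniformly in `k`. -/
theorem exists_abs_deriv_smoothTrunc_le : ∃ B : ℝ, ∀ t, |deriv smoothTrunc t| ≤ B := by
  obtain ⟨B, hB⟩ := (isCompact_Icc (a := (1 : ℝ)) (b := 2)).exists_bound_of_continuousOn
    (contDiff_smoothTrunc.continuous_deriv (by simp)).continuousOn
  refine ⟨max B 1, fun t => ?_⟩
  rcases lt_or_ge t 1 with h1 | h1
  · have : smoothTrunc =ᶠ[𝓝 t] fun _ => 0 := by
      filter_upwards [gt_mem_nhds h1] with s hs using smoothTrunc_of_le_one hs.le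
    rw [this.deriv_eq]
    simp
  rcases le_or_gt t 2 with h2 | h2
  · exact (hB t ⟨h1, h2⟩).trans (le_max_left _ _)
  · rw [deriv_smoothTrunc_of_two_lt h2]
    simp

end Truncation

/-! ### The extremal function: membership in `W₀^{1,2}` and equality. -/

noncomputable section Extremal

/-- The radial profile `r^c sin(κ ln(r/r₁))` of the extremal function. -/
def shellProfile (c κ r₁ r : ℝ) : ℝ := r ^ c * Real.sin (κ * Real.log (r / r₁))

/-- The derivative of `shellProfile`. -/
def shellProfileDeriv (c κ r₁ r : ℝ) : ℝ :=
  r ^ c * (c * Real.sin (κ * Real.log (r / r₁)) + κ * Real.cos (κ * Real.log (r / r₁))) / r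

/-- The smooth truncation of `shellProfile` to the values above `1 / (k + 1)`, cut off outside of
`(r₁, r₂)`. -/
def shellTrunc (c κ r₁ r₂ : ℝ) (k : ℕ) (r : ℝ) : ℝ :=
  (Set.Ioo r₁ r₂).indicator
    (fun s => smoothTrunc ((k + 1 : ℝ) * shellProfile c κ r₁ s) / (k + 1 : ℝ)) r

variable {n : ℕ} {𝕜 : Type*} [RCLike 𝕜] {c κ r₁ r₂ : ℝ}

theorem hasDerivAt_shellProfile (c κ : ℝ) (hr₁ : 0 < r₁) {r : ℝ} (hr : 0 < r) :
    HasDerivAt (shellProfile c κ r₁) (shellProfileDeriv c κ r₁ r) r := by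
  have h := (Real.hasDerivAt_rpow_const (p := c) (Or.inl hr.ne')).mul
    (hasDerivAt_const_mul_log_div κ hr₁ hr).sin
  refine h.congr_deriv ?_
  rw [shellProfileDeriv, Real.rpow_sub_one hr.ne']
  field_simp

theorem contDiffAt_shellProfile (c κ : ℝ) (hr₁ : 0 < r₁) {r : ℝ} (hr : 0 < r)
    {m : WithTop ℕ∞} : ContDiffAt ℝ m (shellProfile c κ r₁) r :=
  (Real.contDiffAt_rpow_const_of_ne hr.ne').mul
    (contDiffAt_const.mul ((contDiffAt_id.div_const r₁).log (div_pos hr hr₁).ne')).sin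

theorem shellProfile_left (hr₁ : 0 < r₁) : shellProfile c κ r₁ r₁ = 0 := by
  simp [shellProfile, div_self hr₁.ne']

theorem shellProfile_right (hr₁ : 0 < r₁) (hr₂ : r₁ < r₂) :
    shellProfile c (Real.pi / Real.log (r₂ / r₁)) r₁ r₂ = 0 := by
  have : 0 < Real.log (r₂ / r₁) := Real.log_pos ((one_lt_div hr₁).2 hr₂)
  rw [shellProfile, div_mul_cancel₀ _ this.ne', Real.sin_pi, mul_zero]

theorem shellProfile_pos (hr₁ : 0 < r₁) {r : ℝ} (hr : r ∈ Set.Ioo r₁ r₂) :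
    0 < shellProfile c (Real.pi / Real.log (r₂ / r₁)) r₁ r :=
  mul_pos (Real.rpow_pos_of_pos (hr₁.trans hr.1) _)
    (Real.sin_pos_of_mem_Ioo (shell_angle_mem_Ioo hr₁ hr))

/-- At an endpoint the profile vanishes, so by continuity `(k + 1) v < 1` nearby and the truncation
is `0` there. This yields both smoothness across the boundary and support inside the open shell. -/
theorem eventually_shellTrunc_eq_zero (hr₁ : 0 < r₁)
    (h₂ : shellProfile c κ r₁ r₂ = 0) (k : ℕ) {r : ℝ} (hr : r ∉ Set.Ioo r₁ r₂) :
    ∀ᶠ s in 𝓝 r, shellTrunc c κ r₁ r₂ k s = 0 := by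
  have hzero : 0 < r → shellProfile c κ r₁ r = 0 →
      ∀ᶠ s in 𝓝 r, shellTrunc c κ r₁ r₂ k s = 0 := by
    intro hr0 h
    have hc : ContinuousAt (fun s => (k + 1 : ℝ) * shellProfile c κ r₁ s) r :=
      continuousAt_const.mul (hasDerivAt_shellProfile c κ hr₁ hr0).continuousAt
    filter_upwards [hc.eventually_lt_const (u := 1) (by simp [h])] with s hs
    rw [shellTrunc, Set.indicator_apply]
    split_ifs
    · rw [smoothTrunc_of_le_one hs.le, zero_div]
    · rfl
  rcases lt_trichotomy r r₁ with h | h | h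
  · filter_upwards [gt_mem_nhds h] with s hs
    exact Set.indicator_of_notMem (fun h' => (hs.trans h'.1).false) _
  · exact hzero (h ▸ hr₁) (by rw [h, shellProfile_left hr₁])
  · rcases (not_lt.1 fun h' => hr ⟨h, h'⟩).lt_or_eq with h' | h'
    · filter_upwards [lt_mem_nhds h'] with s hs
      exact Set.indicator_of_notMem (fun h'' => (hs.trans h''.2).false) _
    · exact hzero (hr₁.trans h) (h' ▸ h₂)

theorem shellTrunc_eventuallyEq (c κ : ℝ) (k : ℕ) {r : ℝ} (hr : r ∈ Set.Ioo r₁ r₂) :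
    shellTrunc c κ r₁ r₂ k =ᶠ[𝓝 r]
      fun s => smoothTrunc ((k + 1 : ℝ) * shellProfile c κ r₁ s) / (k + 1 : ℝ) := by
  filter_upwards [isOpen_Ioo.mem_nhds hr] with s hs using Set.indicator_of_mem hs _

theorem contDiff_shellTrunc (hr₁ : 0 < r₁)
    (h₂ : shellProfile c κ r₁ r₂ = 0) (k : ℕ) : ContDiff ℝ ∞ (shellTrunc c κ r₁ r₂ k) := by
  refine contDiff_iff_contDiffAt.2 fun r => ?_
  by_cases hr : r ∈ Set.Ioo r₁ r₂
  · refine ContDiffAt.congr_of_eventuallyEq ?_ (shellTrunc_eventuallyEq c κ k hr)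
    exact ((contDiff_smoothTrunc.contDiffAt).comp r (contDiffAt_const.mul
      (contDiffAt_shellProfile c κ hr₁ (hr₁.trans hr.1)))).div_const _
  · exact contDiffAt_const.congr_of_eventuallyEq
      (eventually_shellTrunc_eq_zero hr₁ h₂ k hr)

theorem hasDerivAt_shellTrunc (c κ : ℝ) (hr₁ : 0 < r₁) (k : ℕ) {r : ℝ}
    (hr : r ∈ Set.Ioo r₁ r₂) :
    HasDerivAt (shellTrunc c κ r₁ r₂ k)
      (deriv smoothTrunc ((k + 1 : ℝ) * shellProfile c κ r₁ r) * shellProfileDeriv c κ r₁ r) r := by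
  refine HasDerivAt.congr_of_eventuallyEq ?_ (shellTrunc_eventuallyEq c κ k hr)
  have h1 := (hasDerivAt_shellProfile c κ hr₁ (hr₁.trans hr.1)).const_mul (k + 1 : ℝ)
  have h2 : HasDerivAt smoothTrunc _ ((k + 1 : ℝ) * shellProfile c κ r₁ r) :=
    (contDiff_smoothTrunc.differentiable (by simp) _).hasDerivAt
  refine ((h2.comp r h1).div_const (k + 1 : ℝ)).congr_deriv ?_
  have : (k + 1 : ℝ) ≠ 0 := by positivity
  field_simp

theorem abs_shellTrunc_le (c κ : ℝ) (k : ℕ) (r : ℝ) :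
    |shellTrunc c κ r₁ r₂ k r| ≤ |shellProfile c κ r₁ r| := by
  rw [shellTrunc, Set.indicator_apply]
  split_ifs
  · have hk : (0 : ℝ) < k + 1 := by positivity
    rw [abs_div, abs_of_pos hk, div_le_iff₀ hk]
    refine (abs_smoothTrunc_le _).trans_eq ?_
    rw [abs_mul, abs_of_pos hk, mul_comm]
  · simp

/-- Once `(k + 1) v(r) > 2`, the truncation acts as the identity near that value, so all pointwise
limits below are limits of eventually constant sequences. -/
theorem eventually_shellTrunc_eq {r : ℝ} (hr : r ∈ Set.Ioo r₁ r₂)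
    (hpos : 0 < shellProfile c κ r₁ r) :
    ∀ᶠ k : ℕ in atTop, shellTrunc c κ r₁ r₂ k r = shellProfile c κ r₁ r ∧
      deriv smoothTrunc ((k + 1 : ℝ) * shellProfile c κ r₁ r) = 1 := by
  obtain ⟨N, hN⟩ := exists_nat_gt (2 / shellProfile c κ r₁ r)
  filter_upwards [eventually_ge_atTop N] with k hk
  have hlt : 2 < (k + 1 : ℝ) * shellProfile c κ r₁ r := by
    rw [← div_lt_iff₀ hpos]
    have : (N : ℝ) ≤ k := by exact_mod_cast hk
    linarith
  refine ⟨?_, deriv_smoothTrunc_of_two_lt hlt⟩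
  rw [shellTrunc, Set.indicator_of_mem hr, smoothTrunc_of_two_le hlt.le]
  have : (k + 1 : ℝ) ≠ 0 := by positivity
  field_simp

theorem isTestFunction_shellTrunc (hr₁ : 0 < r₁)
    (h₂ : shellProfile c κ r₁ r₂ = 0) (k : ℕ) :
    IsTestFunction (sphericalShell n r₁ r₂)
      (fun x => ((shellTrunc c κ r₁ r₂ k ‖x‖ : ℝ) : 𝕜)) := by
  have hzero : ∀ x ∉ sphericalShell n r₁ r₂,
      (fun x => ((shellTrunc c κ r₁ r₂ k ‖x‖ : ℝ) : 𝕜)) =ᶠ[𝓝 x] 0 := by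
    intro x hx
    filter_upwards [continuous_norm.continuousAt.eventually
      (eventually_shellTrunc_eq_zero hr₁ h₂ k hx)] with y hy
    simp [hy]
  have hsub : tsupport (fun x : EuclideanSpace ℝ (Fin n) =>
      ((shellTrunc c κ r₁ r₂ k ‖x‖ : ℝ) : 𝕜)) ⊆ sphericalShell n r₁ r₂ := by
    intro x hx
    by_contra h
    exact notMem_tsupport_iff_eventuallyEq.2 (hzero x h) hx
  refine ⟨contDiff_iff_contDiffAt.2 fun x => ?_, ?_, hsub⟩
  · by_cases hx : x ∈ sphericalShell n r₁ r₂
    · exact (RCLike.ofRealCLM (K := 𝕜)).contDiff.contDiffAt.comp x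
        ((contDiff_shellTrunc hr₁ h₂ k).contDiffAt.comp x
          (contDiffAt_norm ℝ (ne_zero_of_mem_sphericalShell hr₁.le hx)))
    · exact contDiffAt_const.congr_of_eventuallyEq (hzero x hx)
  · exact Metric.isCompact_of_isClosed_isBounded (isClosed_tsupport _)
      ((isBounded_sphericalShell n r₁ r₂).subset hsub)

theorem abs_shellProfile_le (κ : ℝ) (hr₁ : 0 < r₁) {x : EuclideanSpace ℝ (Fin n)}
    (hx : x ∈ sphericalShell n r₁ r₂) : |shellProfile c κ r₁ ‖x‖| ≤ r₁ ^ c + r₂ ^ c := by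
  rw [shellProfile, abs_mul, abs_of_nonneg (by positivity)]
  exact (mul_le_of_le_one_right (by positivity) (Real.abs_sin_le_one _)).trans
    (norm_rpow_le_of_mem_sphericalShell hr₁ c hx)

theorem abs_shellProfileDeriv_le (κ : ℝ) (hr₁ : 0 < r₁) {x : EuclideanSpace ℝ (Fin n)}
    (hx : x ∈ sphericalShell n r₁ r₂) :
    |shellProfileDeriv c κ r₁ ‖x‖| ≤ (r₁ ^ c + r₂ ^ c) * (|c| + |κ|) / r₁ := by
  have h0 : 0 < ‖x‖ := hr₁.trans hx.1
  have h2 : 0 < r₂ := h0.trans hx.2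
  rw [shellProfileDeriv, abs_div, abs_mul, abs_of_nonneg (by positivity : 0 ≤ ‖x‖ ^ c),
    abs_of_pos h0]
  gcongr
  · exact norm_rpow_le_of_mem_sphericalShell hr₁ c hx
  · refine (abs_add_le _ _).trans ?_
    rw [abs_mul, abs_mul]
    exact add_le_add (mul_le_of_le_one_right (abs_nonneg _) (Real.abs_sin_le_one _))
      (mul_le_of_le_one_right (abs_nonneg _) (Real.abs_cos_le_one _))
  · exact hx.1.le

theorem contDiffOn_radial_shellProfile (n : ℕ) (c κ r₂ : ℝ) (hr₁ : 0 < r₁) :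
    ContDiffOn ℝ 1 (fun x => ((shellProfile c κ r₁ ‖x‖ : ℝ) : 𝕜)) (sphericalShell n r₁ r₂) :=
  (RCLike.ofRealCLM (K := 𝕜)).contDiff.comp_contDiffOn (contDiffOn_radial hr₁.le fun _ hr =>
    (contDiffAt_shellProfile c κ hr₁ (hr₁.trans hr.1)).contDiffWithinAt)

theorem classicalGradient_shellProfile (c κ : ℝ) (hr₁ : 0 < r₁)
    {x : EuclideanSpace ℝ (Fin n)} (hx : x ∈ sphericalShell n r₁ r₂) :
    classicalGradient (fun y => ((shellProfile c κ r₁ ‖y‖ : ℝ) : 𝕜)) x =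
      WithLp.toLp 2 fun i => ((x i / ‖x‖ * shellProfileDeriv c κ r₁ ‖x‖ : ℝ) : 𝕜) :=
  classicalGradient_radial (ne_zero_of_mem_sphericalShell hr₁.le hx)
    (hasDerivAt_shellProfile c κ hr₁ (hr₁.trans hx.1))

theorem memLp_shellProfile (n : ℕ) (c κ r₂ : ℝ) (hr₁ : 0 < r₁) :
    MemLp (fun x => ((shellProfile c κ r₁ ‖x‖ : ℝ) : 𝕜)) 2
      (volume.restrict (sphericalShell n r₁ r₂)) := by
  have hm := (isOpen_sphericalShell n r₁ r₂).measurableSet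
  refine MemLp.of_bound ((contDiffOn_radial_shellProfile n c κ r₂
    hr₁).continuousOn.aestronglyMeasurable hm) (r₁ ^ c + r₂ ^ c) ?_
  filter_upwards [ae_restrict_mem hm] with x hx
  rw [RCLike.norm_ofReal]
  exact abs_shellProfile_le κ hr₁ hx

theorem memLp_classicalGradient_shellProfile (n : ℕ) (c κ r₂ : ℝ) (hr₁ : 0 < r₁) :
    MemLp (classicalGradient fun x => ((shellProfile c κ r₁ ‖x‖ : ℝ) : 𝕜)) 2
      (volume.restrict (sphericalShell n r₁ r₂)) := by
  have ho := isOpen_sphericalShell n r₁ r₂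
  refine MemLp.of_bound ((continuousOn_classicalGradient ho (contDiffOn_radial_shellProfile n c κ r₂
    hr₁)).aestronglyMeasurable ho.measurableSet) ((r₁ ^ c + r₂ ^ c) * (|c| + |κ|) / r₁) ?_
  filter_upwards [ae_restrict_mem ho.measurableSet] with x hx
  rw [classicalGradient_shellProfile c κ hr₁ hx,
    norm_toLp_radial (ne_zero_of_mem_sphericalShell hr₁.le hx)]
  exact abs_shellProfileDeriv_le κ hr₁ hx

theorem memW012_shellProfile (hr₁ : 0 < r₁)
    (h₂ : shellProfile c κ r₁ r₂ = 0) (hpos : ∀ r ∈ Set.Ioo r₁ r₂, 0 < shellProfile c κ r₁ r) :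
    MemW012 (sphericalShell n r₁ r₂) (fun x => ((shellProfile c κ r₁ ‖x‖ : ℝ) : 𝕜)) := by
  have ho := isOpen_sphericalShell n r₁ r₂
  have hC := contDiffOn_radial_shellProfile (𝕜 := 𝕜) n c κ r₂ hr₁
  have ht := isTestFunction_shellTrunc (n := n) (𝕜 := 𝕜) hr₁ h₂
  obtain ⟨B, hB⟩ := exists_abs_deriv_smoothTrunc_le
  refine ⟨memLp_shellProfile n c κ r₂ hr₁, _, hC.hasWeakGradient ho,
    memLp_classicalGradient_shellProfile n c κ r₂ hr₁, _, ht, ?_, ?_⟩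
  · refine eLpNorm_two_tendsto_zero_of_dominated
      (M := (r₁ ^ c + r₂ ^ c) + (r₁ ^ c + r₂ ^ c)) (fun k => ?_) (fun k => ?_) ?_
    · exact (ht k).memLp.1.sub (memLp_shellProfile n c κ r₂ hr₁).1
    · filter_upwards [ae_restrict_mem ho.measurableSet] with x hx
      refine (norm_sub_le _ _).trans ?_
      rw [RCLike.norm_ofReal, RCLike.norm_ofReal]
      have := abs_shellProfile_le (c := c) κ hr₁ hx
      exact add_le_add ((abs_shellTrunc_le c κ k _).trans this) this
    · filter_upwards [ae_restrict_mem ho.measurableSet] with x hx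
      refine tendsto_const_nhds.congr' ?_
      filter_upwards [eventually_shellTrunc_eq hx (hpos _ hx)] with k hk
      rw [hk.1, sub_self]
  -- The gradient error is radial with coefficient `(smoothTrunc' - 1) v'`, which is bounded
  -- uniformly in `k` and eventually zero at each point.
  · have hg : ∀ k : ℕ, ∀ x ∈ sphericalShell n r₁ r₂,
        classicalGradient (fun x => ((shellTrunc c κ r₁ r₂ k ‖x‖ : ℝ) : 𝕜)) x
          - classicalGradient (fun x => ((shellProfile c κ r₁ ‖x‖ : ℝ) : 𝕜)) x
        = WithLp.toLp 2 fun i => ((x i / ‖x‖ *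
          ((deriv smoothTrunc ((k + 1 : ℝ) * shellProfile c κ r₁ ‖x‖) - 1)
            * shellProfileDeriv c κ r₁ ‖x‖) : ℝ) : 𝕜) := by
      intro k x hx
      rw [classicalGradient_shellProfile c κ hr₁ hx,
        classicalGradient_radial (ne_zero_of_mem_sphericalShell hr₁.le hx)
          (hasDerivAt_shellTrunc c κ hr₁ k hx)]
      ext i
      simp only [PiLp.sub_apply]
      push_cast
      ring
    refine eLpNorm_two_tendsto_zero_of_dominated
      (M := (B + 1) * ((r₁ ^ c + r₂ ^ c) * (|c| + |κ|) / r₁)) (fun k => ?_) (fun k => ?_) ?_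
    · exact (ht k).memLp_classicalGradient.1.sub
        (memLp_classicalGradient_shellProfile n c κ r₂ hr₁).1
    · filter_upwards [ae_restrict_mem ho.measurableSet] with x hx
      rw [hg k x hx, norm_toLp_radial (ne_zero_of_mem_sphericalShell hr₁.le hx), abs_mul]
      have hB0 : 0 ≤ B := (abs_nonneg _).trans (hB 0)
      gcongr
      · refine (abs_sub _ _).trans ?_
        rw [abs_one]
        linarith [hB ((k + 1 : ℝ) * shellProfile c κ r₁ ‖x‖)]
      · exact abs_shellProfileDeriv_le κ hr₁ hx
    · filter_upwards [ae_restrict_mem ho.measurableSet] with x hx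
      refine tendsto_const_nhds.congr' ?_
      filter_upwards [eventually_shellTrunc_eq hx (hpos _ hx)] with k hk
      rw [hg k x hx, hk.2]
      ext i
      simp

theorem integral_shellProfile_pos (hn : 0 < n) (β : ℝ) (hr₁ : 0 < r₁) (hr₂ : r₁ < r₂)
    (hpos : ∀ r ∈ Set.Ioo r₁ r₂, 0 < shellProfile c κ r₁ r) :
    0 < ∫ x in sphericalShell n r₁ r₂,
      ‖x‖ ^ β * ‖((shellProfile c κ r₁ ‖x‖ : ℝ) : 𝕜)‖ ^ 2 := by
  have ho := isOpen_sphericalShell n r₁ r₂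
  rw [setIntegral_pos_iff_support_of_nonneg_ae (.of_forall fun x => by positivity)
    (integrableOn_norm_rpow_mul_norm_sq hr₁ β (memLp_shellProfile n c κ r₂ hr₁))]
  have hne : (sphericalShell n r₁ r₂).Nonempty := by
    refine ⟨EuclideanSpace.single ⟨0, hn⟩ ((r₁ + r₂) / 2), ?_⟩
    rw [sphericalShell, Set.mem_ofPred_eq, PiLp.norm_single,
      Real.norm_of_nonneg (by linarith)]
    constructor <;> linarith
  refine (ho.measure_pos volume hne).trans_le (measure_mono fun x hx => ⟨?_, hx⟩)
  have h0 : 0 < ‖x‖ := hr₁.trans hx.1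
  have := hpos _ hx
  rw [Function.mem_support, RCLike.norm_ofReal]
  positivity

theorem contDiffOn_mul_shellProfileDeriv (a c κ r₂ : ℝ) (hr₁ : 0 < r₁) :
    ContDiffOn ℝ 1 (fun r => r ^ a * (c * Real.sin (κ * Real.log (r / r₁))
      + κ * Real.cos (κ * Real.log (r / r₁)))) (Set.Ioo r₁ r₂) := by
  intro r hr
  have hr0 : 0 < r := hr₁.trans hr.1
  have hθ : ContDiffAt ℝ 1 (fun s => κ * Real.log (s / r₁)) r :=
    contDiffAt_const.mul ((contDiffAt_id.div_const r₁).log (div_pos hr0 hr₁).ne')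
  exact ((Real.contDiffAt_rpow_const (Or.inl hr0.ne')).mul
    ((contDiffAt_const.mul hθ.sin).add (contDiffAt_const.mul hθ.cos))).contDiffWithinAt

/-- For `a = α - 2 + c` the function is `r^(α-1) v'`, the radial coefficient `p` with `p(|x|) x =
|x|^α ∇v`. -/
theorem hasDerivAt_mul_shellProfileDeriv (a c κ : ℝ) (hr₁ : 0 < r₁) {r : ℝ} (hr : 0 < r) :
    HasDerivAt (fun r => r ^ a * (c * Real.sin (κ * Real.log (r / r₁))
      + κ * Real.cos (κ * Real.log (r / r₁))))
      (r ^ a * (a * (c * Real.sin (κ * Real.log (r / r₁)) + κ * Real.cos (κ * Real.log (r / r₁)))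
        + κ * (c * Real.cos (κ * Real.log (r / r₁)) - κ * Real.sin (κ * Real.log (r / r₁)))) / r)
      r := by
  have hθ := hasDerivAt_const_mul_log_div κ hr₁ hr
  have h := (Real.hasDerivAt_rpow_const (p := a) (Or.inl hr.ne')).mul
    ((hθ.sin.const_mul c).add (hθ.cos.const_mul κ))
  refine h.congr_deriv ?_
  rw [Real.rpow_sub_one hr.ne']
  simp only [Pi.add_apply]
  field_simp
  ring

/-- Equality holds for the extremal function; obtained by testing its Euler–Lagrange equation with
the truncations and passing to the limit. -/
theorem integral_classicalGradient_shellProfile (α : ℝ) (hr₁ : 0 < r₁)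
    (hc : c = (2 - α - n) / 2)
    (h₂ : shellProfile c κ r₁ r₂ = 0) (hpos : ∀ r ∈ Set.Ioo r₁ r₂, 0 < shellProfile c κ r₁ r) :
    ∫ x in sphericalShell n r₁ r₂,
      ‖x‖ ^ α * ‖classicalGradient (fun y => ((shellProfile c κ r₁ ‖y‖ : ℝ) : 𝕜)) x‖ ^ 2 =
    (c ^ 2 + κ ^ 2) * ∫ x in sphericalShell n r₁ r₂,
      ‖x‖ ^ (α - 2) * ‖((shellProfile c κ r₁ ‖x‖ : ℝ) : 𝕜)‖ ^ 2 := by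
  have ho := isOpen_sphericalShell n r₁ r₂
  have hm := ho.measurableSet
  have hI1 := (integrableOn_norm_rpow_mul_norm_sq hr₁ (α - 2)
    (memLp_shellProfile (𝕜 := 𝕜) n c κ r₂ hr₁)).const_mul (c ^ 2 + κ ^ 2)
  have hI2 := integrableOn_norm_rpow_mul_norm_sq hr₁ α
    (memLp_classicalGradient_shellProfile (𝕜 := 𝕜) n c κ r₂ hr₁)
  obtain ⟨B, hB⟩ := exists_abs_deriv_smoothTrunc_le
  have hgrad : ∀ x ∈ sphericalShell n r₁ r₂,
      ‖classicalGradient (fun y => ((shellProfile c κ r₁ ‖y‖ : ℝ) : 𝕜)) x‖ ^ 2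
        = shellProfileDeriv c κ r₁ ‖x‖ ^ 2 := by
    intro x hx
    rw [classicalGradient_shellProfile c κ hr₁ hx,
      norm_toLp_radial (ne_zero_of_mem_sphericalShell hr₁.le hx), sq_abs]
  -- The integrand of the weak Euler–Lagrange equation of `v`, tested with the `k`-th truncation.
  set J : ℕ → EuclideanSpace ℝ (Fin n) → ℝ := fun k x =>
    deriv smoothTrunc ((k + 1 : ℝ) * shellProfile c κ r₁ ‖x‖)
      * (‖x‖ ^ α * shellProfileDeriv c κ r₁ ‖x‖ ^ 2)
    - (c ^ 2 + κ ^ 2) * (‖x‖ ^ (α - 2) *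
      (shellProfile c κ r₁ ‖x‖ * shellTrunc c κ r₁ r₂ k ‖x‖)) with hJ
  have hJint : ∀ k, IntegrableOn (J k) (sphericalShell n r₁ r₂) ∧
      ∫ x in sphericalShell n r₁ r₂, J k x = 0 := by
    intro k
    have ht : IsTestFunction (sphericalShell n r₁ r₂) (fun x => shellTrunc c κ r₁ r₂ k ‖x‖) :=
      isTestFunction_shellTrunc (𝕜 := ℝ) hr₁ h₂ k
    obtain ⟨hi, h0⟩ := integral_div_radial hr₁.le
      (contDiffOn_mul_shellProfileDeriv (α - 2 + c) c κ r₂ hr₁)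
      (ht.contDiff.of_le (by simp)) ht.hasCompactSupport ht.tsupport_subset
    refine ⟨hi.congr_fun ?heq hm, (setIntegral_congr_fun hm ?heq).symm.trans h0⟩
    case heq =>
      intro x hx
      have hx0 := ne_zero_of_mem_sphericalShell hr₁.le hx
      have hr0 : 0 < ‖x‖ := hr₁.trans hx.1
      have hsum : ∑ i, x i * partialDeriv i (fun y => shellTrunc c κ r₁ r₂ k ‖y‖) x
          = ‖x‖ * (deriv smoothTrunc ((k + 1 : ℝ) * shellProfile c κ r₁ ‖x‖)
            * shellProfileDeriv c κ r₁ ‖x‖) := by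
        simp only [partialDeriv_radial hx0 (hasDerivAt_shellTrunc c κ hr₁ k hx), smul_eq_mul,
          ← mul_assoc, ← Finset.sum_mul]
        congr 2
        have := EuclideanSpace.real_norm_sq_eq x
        simp only [mul_div_assoc', ← sq, ← Finset.sum_div, ← this]
        field_simp
      have hw : ‖x‖ ^ α = ‖x‖ ^ (α - 2) * ‖x‖ ^ 2 := by
        rw [← Real.rpow_natCast, ← Real.rpow_add hr0]
        norm_num
      have hn : (n : ℝ) = 2 - α - 2 * c := by rw [hc]; ring
      simp only [hsum,
        (hasDerivAt_mul_shellProfileDeriv (α - 2 + c) c κ hr₁ hr0).deriv, hJ]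
      -- Here `(α - 2 + c) + n = -c`, so the cosine terms cancel and `-(c² + κ²) sin` remains.
      rw [hn, hw, mul_div_cancel₀ _ hr0.ne', Real.rpow_add hr0]
      simp only [shellProfileDeriv, shellProfile]
      field_simp
      ring
  have hlim : Tendsto (fun k => ∫ x in sphericalShell n r₁ r₂, J k x) atTop
      (𝓝 (∫ x in sphericalShell n r₁ r₂, (‖x‖ ^ α *
        ‖classicalGradient (fun y => ((shellProfile c κ r₁ ‖y‖ : ℝ) : 𝕜)) x‖ ^ 2
        - (c ^ 2 + κ ^ 2) * (‖x‖ ^ (α - 2) * ‖((shellProfile c κ r₁ ‖x‖ : ℝ) : 𝕜)‖ ^ 2)))) := by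
    refine tendsto_integral_of_dominated_convergence _ (fun k => (hJint k).1.1)
      ((hI2.const_mul B).add hI1) (fun k => ?_) ?_
    · filter_upwards [ae_restrict_mem hm] with x hx
      refine (norm_sub_le _ _).trans ?_
      simp only [Pi.add_apply, hgrad x hx, RCLike.norm_ofReal, norm_mul, Real.norm_eq_abs, sq_abs]
      have hsq : |shellProfile c κ r₁ ‖x‖| * |shellTrunc c κ r₁ r₂ k ‖x‖|
          ≤ shellProfile c κ r₁ ‖x‖ ^ 2 := by
        rw [← sq_abs, sq]
        exact mul_le_mul_of_nonneg_left (abs_shellTrunc_le c κ k _) (abs_nonneg _)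
      rw [abs_of_nonneg (by positivity : 0 ≤ ‖x‖ ^ α),
        abs_of_nonneg (by positivity : 0 ≤ ‖x‖ ^ (α - 2)),
        abs_of_nonneg (by positivity : 0 ≤ shellProfileDeriv c κ r₁ ‖x‖ ^ 2),
        abs_of_nonneg (by positivity : 0 ≤ c ^ 2 + κ ^ 2)]
      gcongr
      exact hB _
    · filter_upwards [ae_restrict_mem hm] with x hx
      refine tendsto_const_nhds.congr' ?_
      filter_upwards [eventually_shellTrunc_eq hx (hpos _ hx)] with k hk
      simp only [hJ]
      rw [hk.1, hk.2, hgrad x hx, RCLike.norm_ofReal, sq_abs]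
      ring
  simp only [(hJint _).2] at hlim
  have h0 := tendsto_nhds_unique hlim tendsto_const_nhds
  rw [integral_sub hI2 hI1, integral_const_mul, sub_eq_zero] at h0
  exact h0

end Extremal

/-- The weak gradient is unique up to null sets, so quantifying over all weak gradients `G` of `f`
speaks about `∇f`; membership in `W₀^{1,2}` provides one. -/
theorem theorem2p6 {𝕜 : Type*} [RCLike 𝕜] (n : ℕ) (hn : 2 ≤ n) (α r₁ r₂ : ℝ)
    (hr₁ : 0 < r₁) (hr₂ : r₁ < r₂) :
    -- the inequality, with both integrals finite
    (∀ (f : EuclideanSpace ℝ (Fin n) → 𝕜)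
        (G : EuclideanSpace ℝ (Fin n) → EuclideanSpace 𝕜 (Fin n)),
      MemW012 (sphericalShell n r₁ r₂) f → HasWeakGradient (sphericalShell n r₁ r₂) f G →
        IntegrableOn (fun x => ‖x‖ ^ α * ‖G x‖ ^ 2) (sphericalShell n r₁ r₂) ∧
        IntegrableOn (fun x => ‖x‖ ^ (α - 2) * ‖f x‖ ^ 2) (sphericalShell n r₁ r₂) ∧
        ∫ x in sphericalShell n r₁ r₂, ‖x‖ ^ α * ‖G x‖ ^ 2 ≥
          shellHardyConst n α r₁ r₂ *
            ∫ x in sphericalShell n r₁ r₂, ‖x‖ ^ (α - 2) * ‖f x‖ ^ 2) ∧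
    -- the radial function is a nonzero element of `W₀^{1,2}` for which equality holds
    MemW012 (sphericalShell n r₁ r₂) (shellExtremal 𝕜 n α r₁ r₂) ∧
    0 < ∫ x in sphericalShell n r₁ r₂, ‖x‖ ^ (α - 2) * ‖shellExtremal 𝕜 n α r₁ r₂ x‖ ^ 2 ∧
    (∀ G : EuclideanSpace ℝ (Fin n) → EuclideanSpace 𝕜 (Fin n),
      HasWeakGradient (sphericalShell n r₁ r₂) (shellExtremal 𝕜 n α r₁ r₂) G →
        ∫ x in sphericalShell n r₁ r₂, ‖x‖ ^ α * ‖G x‖ ^ 2 =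
          shellHardyConst n α r₁ r₂ *
            ∫ x in sphericalShell n r₁ r₂,
              ‖x‖ ^ (α - 2) * ‖shellExtremal 𝕜 n α r₁ r₂ x‖ ^ 2) ∧
    -- the constant is optimal
    (∀ C : ℝ,
      (∀ (f : EuclideanSpace ℝ (Fin n) → 𝕜)
          (G : EuclideanSpace ℝ (Fin n) → EuclideanSpace 𝕜 (Fin n)),
        MemW012 (sphericalShell n r₁ r₂) f → HasWeakGradient (sphericalShell n r₁ r₂) f G →
          ∫ x in sphericalShell n r₁ r₂, ‖x‖ ^ α * ‖G x‖ ^ 2 ≥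
            C * ∫ x in sphericalShell n r₁ r₂, ‖x‖ ^ (α - 2) * ‖f x‖ ^ 2) →
      C ≤ shellHardyConst n α r₁ r₂) := by
  set c : ℝ := (2 - α - n) / 2 with hc
  have h₂ := shellProfile_right (c := c) hr₁ hr₂
  have hpos : ∀ r ∈ Set.Ioo r₁ r₂, 0 < shellProfile c (Real.pi / Real.log (r₂ / r₁)) r₁ r :=
    fun r hr => shellProfile_pos hr₁ hr
  have ho := isOpen_sphericalShell n r₁ r₂
  have hK : shellHardyConst n α r₁ r₂ = c ^ 2 + (Real.pi / Real.log (r₂ / r₁)) ^ 2 := by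
    rw [shellHardyConst, hc]; ring
  -- `shellExtremal` unfolds to `shellProfile` with these parameters, so the profile lemmas apply up
  -- to definitional equality.
  have hmem : MemW012 (sphericalShell n r₁ r₂) (shellExtremal 𝕜 n α r₁ r₂) :=
    memW012_shellProfile hr₁ h₂ hpos
  have hI : 0 < ∫ x in sphericalShell n r₁ r₂,
      ‖x‖ ^ (α - 2) * ‖shellExtremal 𝕜 n α r₁ r₂ x‖ ^ 2 :=
    integral_shellProfile_pos (by omega) (α - 2) hr₁ hr₂ hpos
  have hgrad : HasWeakGradient (sphericalShell n r₁ r₂) (shellExtremal 𝕜 n α r₁ r₂)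
      (classicalGradient (shellExtremal 𝕜 n α r₁ r₂)) :=
    (contDiffOn_radial_shellProfile n c _ r₂ hr₁).hasWeakGradient ho
  have heq : ∀ G : EuclideanSpace ℝ (Fin n) → EuclideanSpace 𝕜 (Fin n),
      HasWeakGradient (sphericalShell n r₁ r₂) (shellExtremal 𝕜 n α r₁ r₂) G →
        ∫ x in sphericalShell n r₁ r₂, ‖x‖ ^ α * ‖G x‖ ^ 2 =
          shellHardyConst n α r₁ r₂ *
            ∫ x in sphericalShell n r₁ r₂,
              ‖x‖ ^ (α - 2) * ‖shellExtremal 𝕜 n α r₁ r₂ x‖ ^ 2 := by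
    intro G hG
    rw [hK]
    refine Eq.trans (integral_congr_ae ?_)
      (integral_classicalGradient_shellProfile (𝕜 := 𝕜) α hr₁ hc h₂ hpos)
    filter_upwards [hG.ae_eq ho hgrad] with x hx
    rw [hx]
    rfl
  refine ⟨fun f G hf hG => hardy_of_memW012 α hr₁ hf hG, hmem, hI, heq, fun C hC => ?_⟩
  -- Testing `C` on the extremal function turns both sides into multiples of the same positive
  -- integral.
  have h := hC _ _ hmem hgrad
  rw [heq _ hgrad] at h
  exact le_of_mul_le_mul_right h hI
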